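/- Let $(\mathcal A,G,\alpha)$ be a free C$^*$-dynamical system, i.e. $\mathcal A$ is a unital C$^*$-algebra, $G$ a compact (Hausdorff) group, and $\alpha:G\to\mathrm{Aut}(\mathcal A)$ a strongly continuous group homomorphism such that the Ellwood map $\mathcal A\otimes_{\mathrm{alg}}\mathcal A\to C(G,\mathcal A)$, $x\otimes y\mapsto (g\mapsto x\,\alpha_g(y))$, has dense range. Let $1\to Z\to\hat G\xrightarrow{q} G\to 1$ be a central extension of compact groups, and let $(\hat{\mathcal A},\hat G,\hat\alpha)$ be a $\hat G$-structure for $(\mathcal A,G,\alpha)$, i.e. a free C$^*$-dynamical system such that $\hat{\mathcal A}^Z=\mathcal A$ and $\hat\alpha_{\hat g}|_{\mathcal A}=\alpha_{q(\hat g)}$ for all $\hat g\in\hat G$. Write $\theta=\hat\alpha|_Z$, let $Z^*$ be the Pontryagin dual of $Z$, written additively, and for $\chi\in Z^*$ let $\hat A(\chi)=\{x\in\hat{\mathcal A}:\theta_z(x)=\chi(z)x\ \text{for all } z\in Z\}$. Let $\mathcal U(Z(\mathcal A))$ be the unitary group of the center of $\mathcal A$. Then there is a unique group homomorphism $\Delta:Z^*\to\mathrm{Aut}(\mathcal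 U(Z(\mathcal A)))$ (the Fröhlich map) with $\Delta_\chi(u)x=xu$ for all $\chi\in Z^*$, $u\in\mathcal U(Z(\mathcal A))$, $x\in\hat A(\chi)$. Let $$Z^1_\Delta(Z^*,\mathcal U(Z(\mathcal A)))=\{c:Z^*\to\mathcal U(Z(\mathcal A)) : c(\chi+\chi')=c(\chi)\,\Delta_\chi(c(\chi'))\ \text{for all }\chi,\chi'\in Z^*\}$$ be the Abelian group of crossed homomorphisms under pointwise multiplication, and let $$\mathrm{Gau}_Z(\hat{\mathcal A})=\{\hat\varphi\in\mathrm{Aut}(\hat{\mathcal A}):\theta_z\circ\hat\varphi=\hat\varphi\circ\theta_z\ \text{for all } z\in Z,\ \hat\varphi|_{\mathcal A}=\mathrm{id}_{\mathcal A}\}$$ be the gauge group, where $\mathrm{Aut}$ denotes $^*$-automorphisms. Then there is a group isomorphism $\mathrm{Gau}_Z(\hat{\mathcal A})\to Z^1_\Delta(Z^*,\mathcal U(Z(\mathcal A)))$, $\hat\varphi\mapsto c_{\hat\varphi}$, with $\hat\varphi(x)=c_{\hat\varphi}(\chi)x$ for all $\chi\in Z^*$ and $x\in\hat A(\chi)$.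 In particular, $\mathrm{Gau}_Z(\hat{\mathcal A})$ is Abelian. -/

import Mathlib

open scoped TensorProduct

noncomputable section

/-- A (unital) C*-dynamical system `(A, G, α)`: a strongly continuous action of the
topological group `G` on the unital C*-algebra `A` by *-automorphisms. -/
structure CStarSystem (G A : Type*) [Group G] [TopologicalSpace G] [CStarAlgebra A] where
  act : G →* (A ≃⋆ₐ[ℂ] A)
  continuous_act : ∀ a : A, Continuous fun g : G => act g a

namespace CStarSystem

variable {G H A : Type*} [Group G] [TopologicalSpace G] [Group H] [TopologicalSpace H]
  [CStarAlgebra A]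

/-- The Ellwood map `A ⊗ A → C(G, A)`, `Φ (x ⊗ y) g = x * α_g y`, on the algebraic tensor
product over `ℂ`. -/
def ellwoodMap (α : CStarSystem G A) : A ⊗[ℂ] A →ₗ[ℂ] C(G, A) :=
  TensorProduct.lift <| LinearMap.mk₂ ℂ
    (fun x y => (⟨fun g => x * α.act g y, (α.continuous_act y).const_mul x⟩ : C(G, A)))
    (fun x x' y => by ext g; simp [add_mul])
    (fun c x y => by ext g; simp)
    (fun x y y' => by ext g; simp [mul_add])
    (fun c x y => by ext g; simp)

/-- Freeness: the Ellwood map has dense range. For compact `G` the topology of `C(G, A)` is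
the one of its supremum norm. -/
def IsFree (α : CStarSystem G A) : Prop := DenseRange α.ellwoodMap

/-- The set of fixed points of the action. -/
def fixedPoints (α : CStarSystem G A) : Set A := {a | ∀ g, α.act g a = a}

/-- Restriction of the action along a continuous homomorphism. -/
def restrict (α : CStarSystem G A) (f : H →ₜ* G) : CStarSystem H A where
  act := α.act.comp f.toMonoidHom
  continuous_act a := (α.continuous_act a).comp f.continuous_toFun

/-- The isotypic component `A(χ)` of a character `χ`. -/
def isotypic (α : CStarSystem G A) (χ : PontryaginDual G) : Submodule ℂ A where
  carrier := {x | ∀ g, α.act g x = ((χ g : Circle) : ℂ) • x}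
  add_mem' hx hy g := by rw [map_add, hx g, hy g, smul_add]
  zero_mem' g := by rw [map_zero, smul_zero]
  smul_mem' c x hx g := by rw [map_smul, hx g, smul_comm]

end CStarSystem

/-- A central extension `1 → Z → Ĝ → G → 1` of topological groups (for compact Hausdorff groups
`ι` is automatically a closed embedding and `q` a quotient map). -/
structure CentralExtension (Z Ghat G : Type*) [Group Z] [TopologicalSpace Z] [Group Ghat]
    [TopologicalSpace Ghat] [Group G] [TopologicalSpace G] where
  ι : Z →ₜ* Ghat
  q : Ghat →ₜ* G
  injective_ι : Function.Injective ι
  surjective_q : Function.Surjective q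
  exact : ∀ g : Ghat, q g = 1 ↔ ∃ z : Z, ι z = g
  central : ∀ (z : Z) (g : Ghat), ι z * g = g * ι z

/-- A `Ĝ`-structure `(Â, Ĝ, α̂)` for `(A, G, α)`: a free C*-dynamical system together with an
identification `j` of `A` with the fixed-point algebra of `Z` in `Â`, as `G`-algebras. -/
structure HatStructure {Z Ghat G A : Type*} [Group Z] [TopologicalSpace Z] [Group Ghat]
    [TopologicalSpace Ghat] [Group G] [TopologicalSpace G] [CStarAlgebra A]
    (E : CentralExtension Z Ghat G) (α : CStarSystem G A)
    (Ahat : Type*) [CStarAlgebra Ahat] where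
  sys : CStarSystem Ghat Ahat
  free : sys.IsFree
  j : A →⋆ₐ[ℂ] Ahat
  injective_j : Function.Injective j
  range_j : Set.range j = (sys.restrict E.ι).fixedPoints
  equivariant_j : ∀ (g : Ghat) (a : A), sys.act g (j a) = j (α.act (E.q g) a)

/-- `𝒰(Z(A))`: the group of unitary elements of the center of `A`. -/
def centralUnitaries (A : Type*) [CStarAlgebra A] : Subgroup (unitary A) where
  carrier := {u | ∀ a : A, (u : A) * a = a * (u : A)}
  mul_mem' {u v} hu hv a := by
    rw [Submonoid.coe_mul, mul_assoc, hv a, ← mul_assoc, hu a, mul_assoc]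
  one_mem' a := by simp
  inv_mem' {u} hu a := by
    have h := congrArg star (hu (star a))
    rw [star_mul, star_mul, star_star] at h
    exact h.symm

instance centralUnitaries.instCommGroup (A : Type*) [CStarAlgebra A] :
    CommGroup (centralUnitaries A) :=
  { (inferInstance : Group (centralUnitaries A)) with
    mul_comm := fun u v => Subtype.ext (Subtype.ext (u.2 (v.1 : A))) }

/-- `Z¹_Δ(Z*, 𝒰(Z(A)))`: the group, under pointwise multiplication, of crossed homomorphisms
`c : Z* → 𝒰(Z(A))`. The group `Z*` is written multiplicatively. -/
def crossedHoms {Z A : Type*} [Group Z] [TopologicalSpace Z] [CStarAlgebra A]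
    (Δ : PontryaginDual Z →* MulAut (centralUnitaries A)) :
    Subgroup (PontryaginDual Z → centralUnitaries A) where
  carrier := {c | ∀ χ χ', c (χ * χ') = c χ * Δ χ (c χ')}
  mul_mem' {c d} hc hd χ χ' := by
    rw [Pi.mul_apply, hc, hd, Pi.mul_apply, Pi.mul_apply, map_mul, mul_mul_mul_comm]
  one_mem' χ χ' := by simp
  inv_mem' {c} hc χ χ' := by
    rw [Pi.inv_apply, hc, Pi.inv_apply, Pi.inv_apply, map_inv, mul_inv]

namespace HatStructure

variable {Z Ghat G A Ahat : Type*} [Group Z] [TopologicalSpace Z] [Group Ghat]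
  [TopologicalSpace Ghat] [Group G] [TopologicalSpace G] [CStarAlgebra A] [CStarAlgebra Ahat]
  {E : CentralExtension Z Ghat G} {α : CStarSystem G A}

/-- The two systems have the same fixed-point algebra: a `Ĝ`-structure is a system over the
fixed-point algebra of `(A, G, α)`. -/
theorem fixedPoints_sys (S : HatStructure E α Ahat) :
    S.sys.fixedPoints = S.j '' α.fixedPoints := by
  ext x
  constructor
  · intro hx
    have hx' : x ∈ Set.range S.j := by
      rw [S.range_j]
      exact fun z => hx (E.ι z)
    obtain ⟨a, rfl⟩ := hx'
    refine ⟨a, fun g => ?_, rfl⟩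
    obtain ⟨g, rfl⟩ := E.surjective_q g
    exact S.injective_j ((S.equivariant_j g a).symm.trans (hx g))
  · rintro ⟨a, ha, rfl⟩ g
    rw [S.equivariant_j, ha]

/-- The restriction `θ` of `α̂` to `Z`. -/
def θ (S : HatStructure E α Ahat) : CStarSystem Z Ahat := S.sys.restrict E.ι

/-- The gauge group: the `Z`-equivariant *-automorphisms of `Â` which fix `A` pointwise. -/
def gaugeGroup (S : HatStructure E α Ahat) : Subgroup (Ahat ≃⋆ₐ[ℂ] Ahat) where
  carrier := {φ | (∀ z x, S.θ.act z (φ x) = φ (S.θ.act z x)) ∧ ∀ a, φ (S.j a) = S.j a}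
  mul_mem' {φ ψ} hφ hψ :=
    ⟨fun z x => by
      rw [StarAlgEquiv.mul_apply, StarAlgEquiv.mul_apply, hφ.1, hψ.1],
     fun a => by rw [StarAlgEquiv.mul_apply, hψ.2, hφ.2]⟩
  one_mem' := ⟨fun _ _ => rfl, fun _ => rfl⟩
  inv_mem' {φ} hφ := by
    have h : ∀ y, φ (φ⁻¹ y) = y := fun y => φ.apply_symm_apply y
    have h' : ∀ y, φ⁻¹ (φ y) = y := fun y => φ.symm_apply_apply y
    refine ⟨fun z x => ?_, fun a => ?_⟩
    · rw [← h' (S.θ.act z (φ⁻¹ x)), ← hφ.1, h]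
    · exact (congrArg (⇑φ⁻¹) (hφ.2 a)).symm.trans (h' _)

/-- `Δ` is the Fröhlich map of the `Ĝ`-structure: the action of `Z*` on `𝒰(Z(A))` induced by the
Morita equivalence bimodules `Â(χ)`, i.e. `Δ_χ(u) x = x u` for all `x ∈ Â(χ)`. -/
def IsFrohlichMap (S : HatStructure E α Ahat)
    (Δ : PontryaginDual Z →* MulAut (centralUnitaries A)) : Prop :=
  ∀ (χ : PontryaginDual Z) (u : centralUnitaries A), ∀ x ∈ S.θ.isotypic χ,
    S.j ((Δ χ u : unitary A) : A) * x = x * S.j ((u : unitary A) : A)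

end HatStructure

end

/-! Averaging over the compact abelian group `Z` grades `Â` by `Z*`, with `A` in degree `1`; two
facts about this grading carry everything. The components span a dense subspace
(`dense_iSup_isotypic`), and freeness gives `1 ∈ Â(χ) Â(χ⁻¹)` (`one_mem_isotypic_mul`).

By the second fact, write `1 = ∑ mᵢ nᵢ`. An `A`-bilinear, inner-product preserving surjection `T` of
`Â(χ)` is then left multiplication by `∑ T(mᵢ) nᵢ`, a unique central unitary of `A`
(`exists_centralUnitary`). Right multiplication by `u` yields `Δ_χ(u)`, and a gauge transformation
restricted to `Â(χ)` yields `c(χ)`. The algebraic identities follow by testing on products from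
`Â(χ) Â(χ')`. Injectivity of `φ ↦ c` is density.

For surjectivity, `x ↦ c(χ) x` is defined only on the algebraic span of the components and must be
shown isometric. Its graph is a *-algebra whose two projections to `Â` have dense range and the same
image under the faithful expectation onto `A`, since `c(1) = 1` and all other components average to
zero. A faithful expectation determines the C*-norm, so the map extends to an automorphism
(`exists_starAlgEquiv_of_average_eq`). -/

noncomputable section

/-! ### Smoothing operators of a strongly continuous representation -/

section Averaging

open MeasureTheory

variable {Z E : Type*} [Group Z] [TopologicalSpace Z] [CompactSpace Z] [MeasurableSpace Z]
  [BorelSpace Z] [NormedAddCommGroup E] [NormedSpace ℂ E]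

theorem Continuous.integrable_of_compactSpace {X F : Type*} [TopologicalSpace X] [CompactSpace X]
    [MeasurableSpace X] [BorelSpace X] [NormedAddCommGroup F] (μ : Measure X)
    [IsFiniteMeasureOnCompacts μ] {f : X → F} (hf : Continuous f) : Integrable f μ :=
  hf.integrable_of_hasCompactSupport (.of_compactSpace _)

/-- The integrated form `f ↦ (v ↦ ∫ f(z) U_z v dz)` of a strongly continuous isometric
representation of a compact group. -/
def integratedForm (μ : Measure Z) [IsProbabilityMeasure μ] (U : Z →* (E →L[ℂ] E))
    (hU : ∀ v, Continuous fun z => U z v) (hn : ∀ z v, ‖U z v‖ = ‖v‖) :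
    C(Z, ℂ) →L[ℂ] E →L[ℂ] E :=
  LinearMap.mkContinuous₂
    (LinearMap.mk₂ ℂ (fun f v => ∫ z, f z • U z v ∂μ)
      (fun f g v => by
        simp only [ContinuousMap.add_apply, add_smul]
        exact integral_add ((f.continuous.smul (hU v)).integrable_of_compactSpace μ)
          ((g.continuous.smul (hU v)).integrable_of_compactSpace μ))
      (fun c f v => by
        simp only [ContinuousMap.smul_apply, smul_assoc]
        exact integral_smul c _)
      (fun f v w => by
        simp only [map_add, smul_add]
        exact integral_add ((f.continuous.smul (hU v)).integrable_of_compactSpace μ)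
          ((f.continuous.smul (hU w)).integrable_of_compactSpace μ))
      (fun c f v => by
        simp only [map_smul, smul_comm _ c]
        exact integral_smul c _)) 1
    (fun f v => by
      refine (norm_integral_le_of_norm_le_const (μ := μ) (C := ‖f‖ * ‖v‖)
        (.of_forall fun z => ?_)).trans_eq (by simp)
      rw [norm_smul, hn]
      gcongr
      exact f.norm_coe_le_norm z)

variable {μ : Measure Z} [IsProbabilityMeasure μ] {U : Z →* (E →L[ℂ] E)}
  {hU : ∀ v, Continuous fun z => U z v} {hn : ∀ z v, ‖U z v‖ = ‖v‖}

theorem integratedForm_apply (f : C(Z, ℂ)) (v : E) :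
    integratedForm μ U hU hn f v = ∫ z, f z • U z v ∂μ := rfl

theorem integrable_smul_orbit (hU : ∀ v, Continuous fun z => U z v) (f : C(Z, ℂ)) (v : E) :
    Integrable (fun z => f z • U z v) μ :=
  (f.continuous.smul (hU v)).integrable_of_compactSpace μ

theorem integratedForm_commute [CompleteSpace E] (f : C(Z, ℂ)) {T : E →L[ℂ] E}
    (hT : ∀ z, Commute T (U z)) : Commute T (integratedForm μ U hU hn f) := by
  ext v
  change T (integratedForm μ U hU hn f v) = integratedForm μ U hU hn f (T v)
  rw [integratedForm_apply, integratedForm_apply,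
    ← T.integral_comp_comm (integrable_smul_orbit hU f v)]
  refine integral_congr_ae (.of_forall fun z => ?_)
  have h : T (U z v) = U z (T v) := congr($(hT z) v)
  simp [h]

theorem mul_integratedForm [CompleteSpace E] [IsTopologicalGroup Z] [μ.IsMulLeftInvariant]
    (w : Z) (f : C(Z, ℂ)) (v : E) :
    U w (integratedForm μ U hU hn f v) = ∫ z, f (w⁻¹ * z) • U z v ∂μ := by
  rw [integratedForm_apply,
    ← (U w).integral_comp_comm (integrable_smul_orbit hU f v),
    ← integral_mul_left_eq_self (fun z => f (w⁻¹ * z) • U z v) w]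
  simp

/-- Translation by `z` can be moved onto `f`, and translates of `f` vary continuously in sup norm.
Smoothing thus upgrades strong continuity to norm continuity. -/
theorem continuous_mul_integratedForm [CompleteSpace E] [IsTopologicalGroup Z]
    [μ.IsMulLeftInvariant] (f : C(Z, ℂ)) :
    Continuous fun z => U z * integratedForm μ U hU hn f := by
  let L : C(Z, C(Z, ℂ)) := ContinuousMap.curry ⟨fun p : Z × Z => f (p.1⁻¹ * p.2), by fun_prop⟩
  have h : (fun z => U z * integratedForm μ U hU hn f) =
      fun z => integratedForm μ U hU hn (L z) := by
    ext z v
    exact mul_integratedForm z f v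
  rw [h]
  fun_prop

/-- The witness is a bump of integral one supported where `U z` moves `v` by less than `ε`. -/
theorem exists_integratedForm_near [CompleteSpace E] [T2Space Z] [IsTopologicalGroup Z]
    [μ.IsOpenPosMeasure] (v : E) {ε : ℝ} (hε : 0 < ε) :
    ∃ f : C(Z, ℂ), ‖integratedForm μ U hU hn f v - v‖ ≤ ε := by
  have hN : IsOpen {z | ‖U z v - v‖ < ε} :=
    isOpen_lt ((hU v).sub continuous_const).norm continuous_const
  obtain ⟨f, hf0, hf1, hf⟩ := exists_continuous_zero_one_of_isClosed hN.isClosed_compl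
    (isClosed_singleton (x := (1 : Z))) (by simp [hε])
  have hI : 0 < ∫ z, f z ∂μ := f.continuous.integral_pos_of_hasCompactSupport_nonneg_nonzero
    (.of_compactSpace _) (fun z => (hf z).1) (x := 1) (by simp [hf1 rfl])
  set I := ∫ z, f z ∂μ
  have hint := f.continuous.integrable_of_compactSpace μ
  let g : C(Z, ℂ) := ⟨fun z => ((f z / I : ℝ) : ℂ), by fun_prop⟩
  have hg1 : ∫ z, g z ∂μ = 1 := by
    change ∫ z, ((f z / I : ℝ) : ℂ) ∂μ = 1
    rw [integral_complex_ofReal, integral_div, div_self hI.ne', Complex.ofReal_one]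
  refine ⟨g, ?_⟩
  have hv : v = ∫ z, g z • v ∂μ := by rw [integral_smul_const, hg1, one_smul]
  have h : integratedForm μ U hU hn g v - v = ∫ z, g z • (U z v - v) ∂μ := by
    conv_lhs => rw [integratedForm_apply]; rhs; rw [hv]
    simp only [smul_sub]
    exact (integral_sub (integrable_smul_orbit hU g v)
      ((g.continuous.smul continuous_const).integrable_of_compactSpace μ)).symm
  rw [h]
  have hb : ∫ z, f z / I * ε ∂μ = ε := by
    rw [integral_mul_const, integral_div, div_self hI.ne', one_mul]
  rw [← hb]
  refine norm_integral_le_of_norm_le ((hint.div_const I).mul_const ε) (.of_forall fun z => ?_)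
  have hgz : ‖g z‖ = f z / I := by
    change ‖((f z / I : ℝ) : ℂ)‖ = _
    rw [Complex.norm_real, Real.norm_of_nonneg (div_nonneg (hf z).1 hI.le)]
  rw [norm_smul, hgz]
  by_cases hz : ‖U z v - v‖ < ε
  · exact mul_le_mul_of_nonneg_left hz.le (div_nonneg (hf z).1 hI.le)
  · have : f z = 0 := hf0 hz
    simp [this]

end Averaging

/-! ### Characters of a compact abelian group separate points -/

section Characters

open MeasureTheory

instance ENNReal.fact_two_ne_top : Fact ((2 : ENNReal) ≠ ⊤) := ⟨ENNReal.ofNat_ne_top⟩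

/-- A Gelfand character `ω` detecting `u z₀ * t - t` has `ω t ≠ 0` and `ω (u z₀) ≠ 1`. Dividing `ω
(u z * t)` by `ω t` makes `ω ∘ u` continuous, even if `u` is not norm continuous. -/
theorem exists_character_of_commCStarAlgebra {Z B : Type*} [Group Z]
    [TopologicalSpace Z] [CommCStarAlgebra B] (u : Z →* B) (t : B)
    (hu : ∀ z, star (u z) * u z = 1) (ht : Continuous fun z => u z * t) {z₀ : Z}
    (hne : u z₀ * t ≠ t) : ∃ χ : PontryaginDual Z, χ z₀ ≠ 1 := by
  obtain ⟨ω, hω⟩ : ∃ ω : WeakDual.characterSpace ℂ B, ω (u z₀ * t - t) ≠ 0 := by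
    by_contra! h
    refine sub_ne_zero.2 hne ((gelfandStarTransform B).injective ?_)
    rw [map_zero]
    ext ω
    exact h ω
  rw [map_sub, map_mul, ← sub_one_mul] at hω
  have ht₀ : ω t ≠ 0 := right_ne_zero_of_mul hω
  have hz₀ : ω (u z₀) ≠ 1 := sub_ne_zero.1 (left_ne_zero_of_mul hω)
  have hcirc : ∀ z, ω (u z) ∈ Submonoid.unitSphere ℂ := fun z => by
    have h2 := congrArg ω (hu z)
    rw [map_mul, map_star, map_one] at h2
    have h3 : ‖ω (u z)‖ * ‖ω (u z)‖ = 1 := by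
      rw [← CStarRing.norm_star_mul_self, h2, norm_one]
    exact mem_sphere_zero_iff_norm.2 (by nlinarith [norm_nonneg (ω (u z))])
  have hcont : Continuous fun z => ω (u z) := by
    have h2 : Continuous fun z => ω (u z * t) / ω t := ((map_continuous ω).comp ht).div_const _
    refine h2.congr fun z => ?_
    rw [map_mul, mul_div_cancel_right₀ _ ht₀]
  let χ : Z →ₜ* Circle :=
    { toFun := fun z => ⟨ω (u z), hcirc z⟩
      map_one' := Subtype.ext (by simp)
      map_mul' := fun z w => Subtype.ext ((congrArg ω (map_mul u z w)).trans (map_mul ω _ _))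
      continuous_toFun := hcont.subtype_mk _ }
  exact ⟨χ, fun h => hz₀ (congrArg Subtype.val h)⟩

variable {Z : Type*} [Group Z] [TopologicalSpace Z] [IsTopologicalGroup Z] [CompactSpace Z]
  [T2Space Z]

/-- The left regular representation of a compact group on `L²`. -/
def leftRegular [MeasurableSpace Z] [BorelSpace Z] (μ : Measure Z) [μ.IsHaarMeasure] :
    Z →* (Lp ℂ 2 μ →L[ℂ] Lp ℂ 2 μ) where
  toFun z := LinearMap.mkContinuous
    { toFun := fun v => DomMulAct.mk z⁻¹ • v
      map_add' := fun v w => smul_add _ v w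
      map_smul' := fun c v => smul_comm _ c v } 1
    (fun v => by
      rw [one_mul]
      exact (DomMulAct.norm_smul_Lp (DomMulAct.mk z⁻¹) v).le)
  map_one' := by
    ext1 v
    change DomMulAct.mk (1 : Z)⁻¹ • v = v
    rw [inv_one, DomMulAct.mk_one, one_smul]
  map_mul' z w := by
    ext1 v
    change DomMulAct.mk (z * w)⁻¹ • v = DomMulAct.mk z⁻¹ • DomMulAct.mk w⁻¹ • v
    rw [smul_smul, mul_inv_rev, DomMulAct.mk_mul]

/-- Since `Z` is commutative, the bicommutant of `U` is a commutative C*-algebra. It contains all `U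
z` and the smoothing operators, one of which serves as the element `t` of the previous lemma. -/
theorem exists_character_of_unitary_representation {H : Type*} [NormedAddCommGroup H]
    [InnerProductSpace ℂ H] [CompleteSpace H] (hc : ∀ a b : Z, a * b = b * a)
    (U : Z →* (H →L[ℂ] H)) (hU : ∀ v, Continuous fun z => U z v) (hn : ∀ z v, ‖U z v‖ = ‖v‖)
    {z₀ : Z} {v : H} (hv : U z₀ v ≠ v) : ∃ χ : PontryaginDual Z, χ z₀ ≠ 1 := by
  let _ : MeasurableSpace Z := borel Z
  have _ : BorelSpace Z := ⟨rfl⟩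
  let μ : Measure Z := Measure.haarMeasure ⊤
  have _ : IsProbabilityMeasure μ := ⟨Measure.haarMeasure_self⟩
  let T := integratedForm μ U hU hn
  obtain ⟨f, hf⟩ : ∃ f, U z₀ * T f ≠ T f := by
    obtain ⟨f, hf⟩ := exists_integratedForm_near (μ := μ) (U := U) (hU := hU) (hn := hn) v
      -- If `U z₀` fixed `T f v`, it would move `v` by at most `2ε`, so any `ε` below half the
      -- displacement works.
      (ε := ‖U z₀ v - v‖ / 3) (by have := norm_pos_iff.2 (sub_ne_zero.2 hv); positivity)
    refine ⟨f, fun h => ?_⟩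
    have h1 : U z₀ (T f v) = T f v := congr($h v)
    have h2 : U z₀ v - v = (T f v - v) - U z₀ (T f v - v) := by
      rw [map_sub, h1]; abel
    have h3 : ‖U z₀ v - v‖ ≤ ‖T f v - v‖ + ‖T f v - v‖ := by
      conv_lhs => rw [h2]
      exact (norm_sub_le _ _).trans_eq (by rw [hn])
    have := norm_pos_iff.2 (sub_ne_zero.2 hv)
    change ‖T f v - v‖ ≤ _ at hf
    linarith
  have hstarmul : ∀ z, star (U z) * U z = 1 := fun z =>
    (ContinuousLinearMap.norm_map_iff_adjoint_comp_self (U z)).1 (hn z)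
  have hstar : ∀ z, star (U z) = U z⁻¹ := fun z =>
    left_inv_eq_right_inv (hstarmul z) (by rw [← map_mul, mul_inv_cancel, map_one])
  let C := StarSubalgebra.centralizer ℂ (Set.range U)
  let B := StarSubalgebra.centralizer ℂ (C : Set (H →L[ℂ] H))
  have hC : ∀ S, S ∈ C ↔ ∀ z, Commute S (U z) := fun S => by
    rw [StarSubalgebra.mem_centralizer_iff]
    constructor
    · rintro h z
      exact (h _ ⟨z, rfl⟩).1.symm
    · rintro h _ ⟨z, rfl⟩
      rw [hstar]
      exact ⟨(h z).symm, (h z⁻¹).symm⟩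
  have hB : ∀ S, S ∈ B ↔ ∀ R ∈ C, Commute R S := fun S => by
    rw [StarSubalgebra.mem_centralizer_iff]
    exact ⟨fun h R hR => (h R hR).1, fun h R hR => ⟨h R hR, h _ (star_mem hR)⟩⟩
  have hUC : ∀ z, U z ∈ C := fun z => (hC _).2 fun w => by
    rw [Commute, SemiconjBy, ← map_mul, ← map_mul, hc]
  have hUB : ∀ z, U z ∈ B := fun z => (hB _).2 fun R hR => (hC R).1 hR z
  have hTB : T f ∈ B := (hB _).2 fun R hR => integratedForm_commute f ((hC R).1 hR)
  have hBC : ∀ S ∈ B, S ∈ C := fun S hS => (hC S).2 fun z => ((hB S).1 hS _ (hUC z)).symm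
  have hBclosed : IsClosed (B : Set (H →L[ℂ] H)) := Set.isClosed_centralizer _
  let _ : CommCStarAlgebra B :=
    { (inferInstance : CStarAlgebra B) with
      mul_comm := fun S R => Subtype.ext ((hB R).1 R.2 S (hBC S S.2)) }
  let u : Z →* B :=
    { toFun := fun z => ⟨U z, hUB z⟩
      map_one' := Subtype.ext (map_one U)
      map_mul' := fun z w => Subtype.ext (map_mul U z w) }
  exact exists_character_of_commCStarAlgebra u ⟨T f, hTB⟩
    (fun z => Subtype.ext (hstarmul z))
    (Continuous.subtype_mk (continuous_mul_integratedForm (μ := μ) (hU := hU) (hn := hn) f) _)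
    (fun h => hf (congrArg Subtype.val h))

theorem exists_character_ne_one (hc : ∀ a b : Z, a * b = b * a) {z₀ : Z} (hz : z₀ ≠ 1) :
    ∃ χ : PontryaginDual Z, χ z₀ ≠ 1 := by
  let _ : MeasurableSpace Z := borel Z
  have _ : BorelSpace Z := ⟨rfl⟩
  let μ : Measure Z := Measure.haarMeasure ⊤
  have hU : ∀ v, Continuous fun z => leftRegular μ z v := fun v => by
    have : Continuous fun z : Z => DomMulAct.mk z⁻¹ • v :=
      (DomMulAct.continuous_mk.comp continuous_inv).smul continuous_const
    exact this
  have hn : ∀ z v, ‖leftRegular μ z v‖ = ‖v‖ :=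
    fun z v => DomMulAct.norm_smul_Lp (DomMulAct.mk z⁻¹) v
  obtain ⟨k, hk0, hk1, -⟩ := exists_continuous_zero_one_of_isClosed
    (isClosed_singleton (x := z₀)) (isClosed_singleton (x := (1 : Z))) (by simpa using hz)
  let k' : C(Z, ℂ) := ⟨fun z => ((k z : ℝ) : ℂ), by fun_prop⟩
  let k'' : C(Z, ℂ) := ⟨fun z => ((k (z₀⁻¹ * z) : ℝ) : ℂ), by fun_prop⟩
  refine exists_character_of_unitary_representation hc (leftRegular μ) hU hn (z₀ := z₀)
    (v := ContinuousMap.toLp 2 μ ℂ k') fun h => ?_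
  have h' : leftRegular μ z₀ (ContinuousMap.toLp 2 μ ℂ k') = ContinuousMap.toLp 2 μ ℂ k'' := rfl
  -- Haar measure charges open sets, so equality in `L²` can be evaluated at `z₀`, where it reads `k
  -- 1 = k z₀`.
  have := congr($(ContinuousMap.toLp_injective μ (h'.symm.trans h)) z₀)
  have h0 : k z₀ = 0 := hk0 rfl
  have h1 : k 1 = 1 := hk1 rfl
  simp [k', k'', h0, h1] at this

end Characters

/-! ### Isotypic components and the faithful expectation -/

namespace CStarSystem

open MeasureTheory

variable {G A : Type*} [Group G] [TopologicalSpace G] [CStarAlgebra A]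

theorem mul_mem_isotypic (α : CStarSystem G A) {χ χ' : PontryaginDual G} {x y : A}
    (hx : x ∈ α.isotypic χ) (hy : y ∈ α.isotypic χ') : x * y ∈ α.isotypic (χ * χ') := fun g => by
  have h : (χ * χ') g = χ g * χ' g := rfl
  rw [map_mul, hx g, hy g, h, Circle.coe_mul, smul_mul_smul_comm]

theorem star_mem_isotypic (α : CStarSystem G A) {χ : PontryaginDual G} {x : A}
    (hx : x ∈ α.isotypic χ) : star x ∈ α.isotypic χ⁻¹ := fun g => by
  have h : χ⁻¹ g = (χ g)⁻¹ := rfl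
  rw [map_star, hx g, star_smul, h, Circle.coe_inv_eq_conj]
  rfl

theorem mem_isotypic_one (α : CStarSystem G A) {x : A} :
    x ∈ α.isotypic 1 ↔ x ∈ α.fixedPoints :=
  forall_congr' fun g => by
    have h : ((1 : PontryaginDual G) g : ℂ) • x = x := by simp
    rw [h]

theorem inv_mem_isotypic_one (α : CStarSystem G A) {u : Aˣ} (hu : (u : A) ∈ α.isotypic 1) :
    ((u⁻¹ : Aˣ) : A) ∈ α.isotypic 1 := by
  rw [mem_isotypic_one] at hu ⊢
  intro g
  have h : α.act g ((u⁻¹ : Aˣ) : A) * u = 1 := by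
    conv_lhs => rw [← hu g]
    rw [← map_mul, Units.inv_mul, map_one]
  exact Units.eq_inv_of_mul_eq_one_right h

/-- The action of a C*-dynamical system as a representation on a Banach space. -/
def toRep (α : CStarSystem G A) : G →* (A →L[ℂ] A) where
  toFun g := ⟨(α.act g : A →ₗ[ℂ] A), (StarAlgEquiv.isometry (α.act g)).continuous⟩
  map_one' := by ext x; exact congr($(map_one α.act) x)
  map_mul' g h := by ext x; exact congr($(map_mul α.act g h) x)

theorem norm_act (α : CStarSystem G A) (g : G) (x : A) : ‖α.act g x‖ = ‖x‖ :=
  (StarAlgEquiv.isometry (α.act g)).norm_map_of_map_zero (map_zero _) x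

/-- A character as a continuous complex-valued function. -/
def _root_.PontryaginDual.toContinuousMap (χ : PontryaginDual G) : C(G, ℂ) :=
  ⟨fun g => χ g, by fun_prop⟩

theorem act_nonneg [PartialOrder A] [StarOrderedRing A] (α : CStarSystem G A) (g : G) {x : A}
    (hx : 0 ≤ x) : 0 ≤ α.act g x :=
  map_nonneg (α.act g) hx

variable [CompactSpace G] [MeasurableSpace G] [BorelSpace G]

/-- The operators `x ↦ ∫ f(g) α_g(x) dg`. -/
def average (α : CStarSystem G A) (μ : Measure G) [IsProbabilityMeasure μ] :
    C(G, ℂ) →L[ℂ] A →L[ℂ] A :=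
  integratedForm μ α.toRep α.continuous_act α.norm_act

variable (α : CStarSystem G A) {μ : Measure G} [IsProbabilityMeasure μ]

theorem average_apply (f : C(G, ℂ)) (x : A) : α.average μ f x = ∫ g, f g • α.act g x ∂μ := rfl

theorem average_one_apply (x : A) : α.average μ 1 x = ∫ g, α.act g x ∂μ := by
  simp [average_apply]

theorem average_one_of_fixed {x : A} (hx : x ∈ α.fixedPoints) : α.average μ 1 x = x := by
  rw [average_one_apply, integral_congr_ae (.of_forall hx)]
  simp

theorem norm_average_one_le (x : A) : ‖α.average μ 1 x‖ ≤ ‖x‖ := by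
  rw [average_one_apply]
  refine (norm_integral_le_of_norm_le_const (μ := μ) (C := ‖x‖)
    (.of_forall fun g => (α.norm_act g x).le)).trans_eq (by simp)

theorem average_mul_right_of_mem_isotypic {χ : PontryaginDual G} (f : C(G, ℂ)) (x : A) {y : A}
    (hy : y ∈ α.isotypic χ) :
    α.average μ f (x * y) = α.average μ (f * χ.toContinuousMap) x * y := by
  have hint : Integrable (fun g => (f * χ.toContinuousMap) g • α.act g x) μ :=
    integrable_smul_orbit (U := α.toRep) α.continuous_act _ x
  rw [average_apply, average_apply, ← integral_mul_const_of_integrable hint]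
  refine integral_congr_ae (.of_forall fun g => ?_)
  have h : (f * χ.toContinuousMap) g = f g * χ g := rfl
  simp only [map_mul, hy g, h, mul_smul, mul_smul_comm, smul_mul_assoc]

section Invariant

variable [IsTopologicalGroup G] [μ.IsMulLeftInvariant]

theorem average_mem_isotypic (χ : PontryaginDual G) (x : A) :
    α.average μ χ⁻¹.toContinuousMap x ∈ α.isotypic χ := fun g => by
  refine (mul_integratedForm (U := α.toRep) g χ⁻¹.toContinuousMap x).trans ?_
  rw [average_apply, ← integral_smul]
  refine integral_congr_ae (.of_forall fun h => ?_)
  have h1 : χ⁻¹.toContinuousMap (g⁻¹ * h) = (χ g : ℂ) * χ⁻¹.toContinuousMap h := by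
    change (((χ (g⁻¹ * h))⁻¹ : Circle) : ℂ) = (χ g : ℂ) * (((χ h)⁻¹ : Circle) : ℂ)
    rw [map_mul, map_inv, mul_inv, inv_inv, Circle.coe_mul]
  simp only [h1, mul_smul]
  rfl

theorem average_one_mem_fixedPoints (x : A) : α.average μ 1 x ∈ α.fixedPoints :=
  have h : (1⁻¹ : PontryaginDual G).toContinuousMap = 1 := by
    rw [inv_one]
    rfl
  α.mem_isotypic_one.1 (h ▸ α.average_mem_isotypic (μ := μ) 1 x)

theorem average_one_of_mem_isotypic {χ : PontryaginDual G} (hχ : χ ≠ 1) {x : A}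
    (hx : x ∈ α.isotypic χ) : α.average μ 1 x = 0 := by
  obtain ⟨g, hg⟩ : ∃ g, χ g ≠ 1 := by
    by_contra! h
    exact hχ (PontryaginDual.ext h)
  have h1 : α.average μ 1 x ∈ α.isotypic χ := by
    -- With left factor `1`, the average of `x` is the scalar `∫ χ` times `x`. It is both fixed and
    -- of type `χ`, hence zero.
    have := α.average_mul_right_of_mem_isotypic (μ := μ) 1 1 hx
    rw [one_mul, one_mul] at this
    rw [this, average_apply]
    simp only [map_one]
    rw [integral_smul_const, smul_mul_assoc, one_mul]
    exact Submodule.smul_mem _ _ hx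
  have h2 := α.average_one_mem_fixedPoints (μ := μ) x g
  rw [h1 g] at h2
  have h3 : ((χ g : ℂ) - 1) • α.average μ 1 x = 0 := by rw [sub_smul, one_smul, h2, sub_self]
  exact (smul_eq_zero.1 h3).resolve_left (sub_ne_zero.2 fun h => hg (Circle.ext h))

end Invariant

section Order

variable [PartialOrder A] [StarOrderedRing A]

theorem average_one_mono {x y : A} (h : x ≤ y) : α.average μ 1 x ≤ α.average μ 1 y := by
  rw [average_one_apply, average_one_apply]
  refine integral_mono ((α.continuous_act x).integrable_of_compactSpace μ)
    ((α.continuous_act y).integrable_of_compactSpace μ) fun g => ?_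
  rw [← sub_nonneg, ← map_sub]
  exact α.act_nonneg g (sub_nonneg.2 h)

theorem average_one_nonneg {x : A} (h : 0 ≤ x) : 0 ≤ α.average μ 1 x := by
  simpa using α.average_one_mono (μ := μ) h

theorem eq_zero_of_average_one_eq_zero [μ.IsOpenPosMeasure] {x : A} (hx : 0 ≤ x)
    (h : α.average μ 1 x = 0) : x = 0 := by
  by_contra hx0
  have hε : 0 < ‖x‖ / 2 := half_pos (norm_pos_iff.2 hx0)
  -- By positivity the integral over `N` vanishes too, yet it lies within `μ(N) ‖x‖ / 2` of `μ(N)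
  -- x`.
  set N := {g | ‖α.act g x - x‖ < ‖x‖ / 2}
  have hN : IsOpen N :=
    isOpen_lt ((α.continuous_act x).sub continuous_const).norm continuous_const
  have hint := (α.continuous_act x).integrable_of_compactSpace μ
  have hzero : ∫ g in N, α.act g x ∂μ = 0 := by
    rw [average_one_apply, ← integral_add_compl hN.measurableSet hint] at h
    exact le_antisymm (by
      rw [eq_neg_of_add_eq_zero_left h, neg_nonpos]
      exact integral_nonneg fun g => α.act_nonneg g hx)
      (integral_nonneg fun g => α.act_nonneg g hx)
  have hpos : 0 < μ.real N := by
    rw [measureReal_def, ENNReal.toReal_pos_iff]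
    exact ⟨hN.measure_pos μ ⟨1, by simpa [N] using hx0⟩, measure_lt_top _ _⟩
  have h1 : ‖∫ g in N, (α.act g x - x) ∂μ‖ ≤ ‖x‖ / 2 * μ.real N :=
    norm_setIntegral_le_of_norm_le_const (measure_lt_top _ _) fun g hg => le_of_lt hg
  rw [integral_sub hint.integrableOn (integrable_const _), hzero, zero_sub, norm_neg,
    setIntegral_const, norm_smul, Real.norm_of_nonneg hpos.le] at h1
  nlinarith

/-- Boundedness can be tested on the Hilbert module of a faithful expectation. -/
theorem norm_le_of_norm_average_le [μ.IsOpenPosMeasure] {h : A} (hh : 0 ≤ h) {M : ℝ} (hM : 0 ≤ M)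
    (H : ∀ ξ : A, ‖α.average μ 1 (star ξ * h * ξ)‖ ≤ M * ‖α.average μ 1 (star ξ * ξ)‖) :
    ‖h‖ ≤ M := by
  refine le_of_forall_gt_imp_ge_of_dense fun m hm => ?_
  have hm0 : 0 ≤ m := hM.trans hm.le
  rw [CStarAlgebra.norm_le_iff_le_algebraMap h hm0 hh, ← sub_nonpos]
  set k := h - algebraMap ℝ A m with hk
  have hsa : IsSelfAdjoint k := hh.isSelfAdjoint.sub (IsSelfAdjoint.algebraMap A (.all m))
  rw [← CFC.posPart_eq_zero_iff k hsa]
  -- Here `ξ k ξ = ξ³ ≥ 0`, so `m ξ² ≤ ξ h ξ`. Averaging and `m > M` force the average of `ξ²` to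
  -- vanish, and faithfulness gives `ξ = 0`.
  set ξ := k⁺
  have hξ0 : 0 ≤ ξ := CFC.posPart_nonneg k
  have hξ : star ξ = ξ := hξ0.isSelfAdjoint
  have h1 : ξ * k * ξ = star ξ * ξ * ξ := by
    conv_lhs => rw [← CFC.posPart_sub_negPart k hsa]
    rw [mul_sub, CFC.posPart_mul_negPart, sub_zero, hξ]
  have h2 : m • (star ξ * ξ) ≤ star ξ * h * ξ := by
    have h3 : star ξ * h * ξ - m • (star ξ * ξ) = star ξ * ξ * ξ := by
      rw [← h1, hk, hξ, mul_sub, sub_mul, ← Algebra.commutes, ← Algebra.smul_def, smul_mul_assoc]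
    rw [← sub_nonneg, h3, hξ]
    have := star_left_conjugate_nonneg hξ0 ξ
    rwa [hξ] at this
  have h4 : m * ‖α.average μ 1 (star ξ * ξ)‖ ≤ M * ‖α.average μ 1 (star ξ * ξ)‖ := by
    refine le_trans ?_ (H ξ)
    have h5 : α.average μ 1 (m • (star ξ * ξ)) = m • α.average μ 1 (star ξ * ξ) :=
      ContinuousLinearMap.map_smul_of_tower _ _ _
    have h6 := CStarAlgebra.norm_le_norm_of_nonneg_of_le
      (α.average_one_nonneg (smul_nonneg hm0 (star_mul_self_nonneg ξ))) (α.average_one_mono (μ := μ) h2)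
    rwa [h5, norm_smul, Real.norm_of_nonneg hm0] at h6
  have h7 : ‖α.average μ 1 (star ξ * ξ)‖ = 0 := by
    nlinarith [norm_nonneg (α.average μ 1 (star ξ * ξ))]
  exact CStarRing.star_mul_self_eq_zero_iff ξ |>.1
    (α.eq_zero_of_average_one_eq_zero (star_mul_self_nonneg ξ) (norm_eq_zero.1 h7))

theorem norm_average_conj_le (a ξ : A) :
    ‖α.average μ 1 (star ξ * (star a * a) * ξ)‖ ≤ ‖a‖ ^ 2 * ‖α.average μ 1 (star ξ * ξ)‖ := by
  have h1 : star ξ * (star a * a) * ξ ≤ (‖a‖ ^ 2) • (star ξ * ξ) := by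
    have := star_left_conjugate_le_conjugate (CStarAlgebra.star_mul_le_algebraMap_norm_sq (a := a)) ξ
    rwa [← Algebra.commutes, mul_assoc (algebraMap ℝ A _), ← Algebra.smul_def] at this
  have h2 := CStarAlgebra.norm_le_norm_of_nonneg_of_le (α.average_one_nonneg (μ := μ)
    (star_left_conjugate_nonneg (star_mul_self_nonneg a) ξ)) (α.average_one_mono (μ := μ) h1)
  have h5 : α.average μ 1 ((‖a‖ ^ 2) • (star ξ * ξ)) = (‖a‖ ^ 2) • α.average μ 1 (star ξ * ξ) :=
    ContinuousLinearMap.map_smul_of_tower _ _ _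
  rwa [h5, norm_smul, Real.norm_of_nonneg (sq_nonneg _)] at h2

end Order

section Extension

variable {B : Type*} [Ring B] [StarRing B] [Algebra ℂ B]

/-- If two *-homomorphisms agree after averaging and the second one has dense range, then the
first one dominates the second one in norm. -/
theorem norm_le_norm_of_average_eq [μ.IsOpenPosMeasure] {π₁ π₂ : B →⋆ₐ[ℂ] A}
    (hE : ∀ b, α.average μ 1 (π₁ b) = α.average μ 1 (π₂ b)) (hd : DenseRange π₂) (b : B) :
    ‖π₂ b‖ ≤ ‖π₁ b‖ := by
  let _ := CStarAlgebra.spectralOrder A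
  have _ := CStarAlgebra.spectralOrderedRing A
  have key : ‖star (π₂ b) * π₂ b‖ ≤ ‖π₁ b‖ ^ 2 := by
    refine α.norm_le_of_norm_average_le (μ := μ) (star_mul_self_nonneg _) (sq_nonneg _) fun ξ => ?_
    refine hd.induction_on (p := fun ξ => ‖α.average μ 1 (star ξ * (star (π₂ b) * π₂ b) * ξ)‖ ≤
      ‖π₁ b‖ ^ 2 * ‖α.average μ 1 (star ξ * ξ)‖) ξ
      (isClosed_le (by fun_prop) (by fun_prop)) fun c => ?_
    -- Equal averages transport both sides from `π₂` to `π₁`, where the estimate is the usual bound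
    -- for conjugation.
    have h1 := hE (star c * (star b * b) * c)
    have h2 := hE (star c * c)
    simp only [map_mul, map_star] at h1 h2
    rw [← h1, ← h2]
    exact α.norm_average_conj_le (π₁ b) (π₁ c)
  rw [CStarRing.norm_star_mul_self, ← sq] at key
  exact pow_le_pow_iff_left₀ (norm_nonneg _) (norm_nonneg _) two_ne_zero |>.1 key

theorem _root_.StarAlgHom.bijective_of_norm_map_of_denseRange {A₁ A₂ : Type*} [NormedRing A₁]
    [StarRing A₁] [NormedAlgebra ℂ A₁] [CompleteSpace A₁] [NormedRing A₂] [StarRing A₂]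
    [NormedAlgebra ℂ A₂] (f : A₁ →⋆ₐ[ℂ] A₂) (hf : ∀ x, ‖f x‖ = ‖x‖) (hd : DenseRange f) :
    Function.Bijective f := by
  have h := AddMonoidHomClass.isometry_of_norm f hf
  refine ⟨h.injective, fun y => ?_⟩
  have h2 : IsClosed (Set.range f) := h.isClosedEmbedding.isClosed_range
  have h3 : y ∈ closure (Set.range f) := hd y
  rwa [h2.closure_eq] at h3

/-- On the closure `Γ` of all pairs `(π₁ b, π₂ b)` the two coordinates have equal norm. Both
projections are therefore isometric with dense range, hence bijective, and `φ` is one after the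
inverse of the other. -/
theorem exists_starAlgEquiv_of_average_eq [μ.IsOpenPosMeasure] (π₁ π₂ : B →⋆ₐ[ℂ] A)
    (hE : ∀ b, α.average μ 1 (π₁ b) = α.average μ 1 (π₂ b)) (hd₁ : DenseRange π₁)
    (hd₂ : DenseRange π₂) : ∃ φ : A ≃⋆ₐ[ℂ] A, ∀ b, φ (π₁ b) = π₂ b := by
  let Γ : StarSubalgebra ℂ (A × A) := (StarAlgHom.range (π₁.prod π₂)).topologicalClosure
  have hΓ : ∀ b, (π₁ b, π₂ b) ∈ Γ := fun b => subset_closure ⟨b, rfl⟩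
  have hnorm : ∀ p ∈ Γ, ‖p.1‖ = ‖p.2‖ := fun p hp => by
    refine closure_minimal (t := {p : A × A | ‖p.1‖ = ‖p.2‖}) ?_
      (isClosed_eq (by fun_prop) (by fun_prop)) hp
    rintro _ ⟨b, rfl⟩
    exact le_antisymm (α.norm_le_norm_of_average_eq (fun b => (hE b).symm) hd₁ b)
      (α.norm_le_norm_of_average_eq hE hd₂ b)
  have _ : CompleteSpace Γ := (StarSubalgebra.isClosed_topologicalClosure _).completeSpace_coe
  let f₁ : Γ →⋆ₐ[ℂ] A := (StarAlgHom.fst ℂ A A).comp Γ.subtype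
  let f₂ : Γ →⋆ₐ[ℂ] A := (StarAlgHom.snd ℂ A A).comp Γ.subtype
  have hf₁ : Function.Bijective f₁ := by
    refine f₁.bijective_of_norm_map_of_denseRange (fun p => ?_)
      (hd₁.mono (by rintro _ ⟨b, rfl⟩; exact ⟨⟨_, hΓ b⟩, rfl⟩))
    exact ((max_eq_left (hnorm p p.2).ge).symm : ‖p.1.1‖ = ‖p.1‖)
  have hf₂ : Function.Bijective f₂ := by
    refine f₂.bijective_of_norm_map_of_denseRange (fun p => ?_)
      (hd₂.mono (by rintro _ ⟨b, rfl⟩; exact ⟨⟨_, hΓ b⟩, rfl⟩))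
    exact ((max_eq_right (hnorm p p.2).le).symm : ‖p.1.2‖ = ‖p.1‖)
  refine ⟨(StarAlgEquiv.ofBijective f₁ hf₁).symm.trans (StarAlgEquiv.ofBijective f₂ hf₂),
    fun b => ?_⟩
  have h : (StarAlgEquiv.ofBijective f₁ hf₁).symm (π₁ b) = ⟨_, hΓ b⟩ :=
    (StarAlgEquiv.ofBijective f₁ hf₁).symm_apply_apply ⟨_, hΓ b⟩
  rw [StarAlgEquiv.trans_apply, h]
  rfl

end Extension

end CStarSystem

/-! ### Stone–Weierstrass for trigonometric polynomials -/

namespace PontryaginDual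

variable {G : Type*} [Group G] [TopologicalSpace G]

/-- The trigonometric polynomials: the *-algebra of functions generated by the characters. -/
def trigPolynomials (G : Type*) [Group G] [TopologicalSpace G] : StarSubalgebra ℂ C(G, ℂ) where
  toSubalgebra := Algebra.adjoin ℂ (Set.range (toContinuousMap (G := G)))
  star_mem' {f} hf := by
    change star f ∈ Algebra.adjoin ℂ _
    induction hf using Algebra.adjoin_induction with
    | mem f hf =>
      obtain ⟨χ, rfl⟩ := hf
      refine Algebra.subset_adjoin ⟨χ⁻¹, ?_⟩
      ext g
      exact Circle.coe_inv_eq_conj (χ g)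
    | algebraMap r =>
      rw [← algebraMap_star_comm]
      exact Subalgebra.algebraMap_mem _ _
    | add f g _ _ hf hg =>
      rw [star_add]
      exact add_mem hf hg
    | mul f g _ _ hf hg =>
      rw [star_mul]
      exact mul_mem hg hf

theorem toSubmodule_trigPolynomials :
    Subalgebra.toSubmodule (trigPolynomials G).toSubalgebra =
      Submodule.span ℂ (Set.range (toContinuousMap (G := G))) := by
  let m : PontryaginDual G →* C(G, ℂ) :=
    { toFun := toContinuousMap, map_one' := rfl, map_mul' := fun _ _ => rfl }
  refine (Algebra.adjoin_eq_span ℂ (Set.range (toContinuousMap (G := G)))).trans ?_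
  congr 1
  exact congrArg SetLike.coe (Submonoid.closure_eq (MonoidHom.mrange m))

theorem trigPolynomials_topologicalClosure [IsTopologicalGroup G] [CompactSpace G] [T2Space G]
    (hc : ∀ a b : G, a * b = b * a) : (trigPolynomials G).topologicalClosure = ⊤ := by
  refine ContinuousMap.starSubalgebra_topologicalClosure_eq_top_of_separatesPoints _
    fun x y hxy => ?_
  obtain ⟨χ, hχ⟩ := exists_character_ne_one hc (z₀ := x * y⁻¹) (mul_inv_eq_one.not.2 hxy)
  refine ⟨_, ⟨toContinuousMap χ, Algebra.subset_adjoin ⟨χ, rfl⟩, rfl⟩, fun h => hχ ?_⟩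
  refine (_root_.map_mul χ x y⁻¹).trans ?_
  rw [map_inv, mul_inv_eq_one]
  exact Circle.ext h

theorem dense_span_characters [IsTopologicalGroup G] [CompactSpace G] [T2Space G]
    (hc : ∀ a b : G, a * b = b * a) :
    Dense (Submodule.span ℂ (Set.range (toContinuousMap (G := G))) : Set C(G, ℂ)) := by
  rw [← toSubmodule_trigPolynomials, dense_iff_closure_eq]
  exact congrArg SetLike.coe (trigPolynomials_topologicalClosure hc)

end PontryaginDual

/-! ### Density and fullness of the isotypic components -/

namespace CStarSystem

open MeasureTheory

variable {G H A : Type*} [Group G] [TopologicalSpace G] [IsTopologicalGroup G] [CompactSpace G]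
  [T2Space G] [CStarAlgebra A]

/-- The isotypic components of a compact abelian group span a dense subspace. -/
theorem dense_iSup_isotypic (hc : ∀ a b : G, a * b = b * a) (α : CStarSystem G A) :
    Dense ((⨆ χ, α.isotypic χ : Submodule ℂ A) : Set A) := by
  let _ : MeasurableSpace G := borel G
  have _ : BorelSpace G := ⟨rfl⟩
  let μ : Measure G := Measure.haarMeasure ⊤
  have _ : IsProbabilityMeasure μ := ⟨Measure.haarMeasure_self⟩
  set W : Submodule ℂ A := ⨆ χ, α.isotypic χ
  have hW : ∀ (f : C(G, ℂ)) (x : A), α.average μ f x ∈ closure (W : Set A) := fun f x => by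
    refine map_mem_closure (f := fun f => α.average μ f x) (by fun_prop)
      (PontryaginDual.dense_span_characters hc f) fun g hg => ?_
    induction hg using Submodule.span_induction with
    | mem g hg =>
      obtain ⟨χ, rfl⟩ := hg
      have := α.average_mem_isotypic (μ := μ) χ⁻¹ x
      rw [inv_inv] at this
      exact Submodule.mem_iSup_of_mem _ this
    | zero => simp
    | add f g _ _ hf hg =>
      simpa using W.add_mem hf hg
    | smul c f _ hf =>
      simpa using W.smul_mem c hf
  intro x
  rw [← closure_closure, Metric.mem_closure_iff]
  intro ε hε
  obtain ⟨f, hf⟩ := exists_integratedForm_near (μ := μ) (U := α.toRep) (hU := α.continuous_act)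
    (hn := α.norm_act) x (half_pos hε)
  refine ⟨_, hW f x, ?_⟩
  rw [dist_comm, dist_eq_norm]
  exact hf.trans_lt (half_lt_self hε)

theorem ext_of_isotypic {B : Type*} [TopologicalSpace B] [T2Space B] [AddCommMonoid B] [Module ℂ B]
    (hc : ∀ a b : G, a * b = b * a) (α : CStarSystem G A) {f g : A →ₗ[ℂ] B} (hf : Continuous f)
    (hg : Continuous g) (h : ∀ χ, ∀ x ∈ α.isotypic χ, f x = g x) : f = g := by
  refine DFunLike.coe_injective (hf.ext_on (α.dense_iSup_isotypic hc) hg fun x hx => ?_)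
  have : (⨆ χ, α.isotypic χ) ≤ LinearMap.eqLocus f g := iSup_le fun χ x hx => h χ x hx
  exact this hx

/-- Freeness passes to closed subgroups, and forces the isotypic components to be full. -/
theorem IsFree.one_mem_isotypic_mul [Group H] [TopologicalSpace H] [IsTopologicalGroup H]
    [CompactSpace H] [T2Space H] {α : CStarSystem G A} (hα : α.IsFree) {f : H →ₜ* G}
    (hf : Function.Injective f) (χ : PontryaginDual H) :
    1 ∈ (α.restrict f).isotypic χ⁻¹ * (α.restrict f).isotypic χ := by
  let _ : MeasurableSpace H := borel H
  have _ : BorelSpace H := ⟨rfl⟩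
  let μ : Measure H := Measure.haarMeasure ⊤
  have _ : IsProbabilityMeasure μ := ⟨Measure.haarMeasure_self⟩
  set θ := α.restrict f with hθ
  set M := θ.isotypic χ⁻¹ * θ.isotypic χ
  -- Tietze extension from the closed image of `H`; `g` need not be a character.
  obtain ⟨g, hg⟩ := ContinuousMap.exists_extension
    ((map_continuous f).isClosedEmbedding hf) χ.toContinuousMap
  have hg : ∀ z, g (f z) = χ z := fun z => congr($hg z)
  let F : C(G, A) := ⟨fun h => g h • 1, by fun_prop⟩
  obtain ⟨t, ht⟩ := hα.exists_dist_lt F one_pos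
  let c := χ⁻¹.toContinuousMap
  have hcont : ∀ t, Continuous fun z => c z • α.ellwoodMap t (f z) := fun t =>
    c.continuous.smul ((α.ellwoodMap t).continuous.comp (map_continuous f))
  -- On `x ⊗ y` the inner integral projects `y` to type `χ`; averaging again then projects `x` to
  -- type `χ⁻¹`.
  have hP : ∀ t, θ.average μ 1 (∫ z, c z • α.ellwoodMap t (f z) ∂μ) ∈ M := fun t => by
    induction t using TensorProduct.induction_on with
    | zero => simp
    | tmul x y =>
      have h1 : ∫ z, c z • α.ellwoodMap (x ⊗ₜ y) (f z) ∂μ = x * θ.average μ c y := by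
        have hint : Integrable (fun z => c z • θ.act z y) μ :=
          (c.continuous.smul (θ.continuous_act y)).integrable_of_compactSpace μ
        rw [average_apply, ← integral_const_mul_of_integrable hint]
        refine integral_congr_ae (.of_forall fun z => ?_)
        exact (mul_smul_comm _ _ _).symm
      have h2 : θ.average μ c y ∈ θ.isotypic χ := θ.average_mem_isotypic χ y
      rw [h1, θ.average_mul_right_of_mem_isotypic _ _ h2, one_mul]
      refine Submodule.mul_mem_mul ?_ h2
      have := θ.average_mem_isotypic (μ := μ) χ⁻¹ x
      rwa [inv_inv] at this
    | add s t hs ht =>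
      simp only [map_add, ContinuousMap.add_apply, smul_add]
      rw [integral_add ((hcont s).integrable_of_compactSpace μ)
        ((hcont t).integrable_of_compactSpace μ), map_add]
      exact add_mem hs ht
  set p := ∫ z, c z • α.ellwoodMap t (f z) ∂μ with hp
  have hcg : ∀ z, c z * g (f z) = 1 := fun z => by
    rw [hg]
    exact congrArg Subtype.val (inv_mul_cancel (χ z))
  have hp1 : ‖p - 1‖ < 1 := by
    have h1 : p - 1 = ∫ z, c z • (α.ellwoodMap t (f z) - F (f z)) ∂μ := by
      have h2 : (1 : A) = ∫ z, c z • F (f z) ∂μ := by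
        have h3 : ∀ z, c z • F (f z) = 1 := fun z => by
          change c z • g (f z) • (1 : A) = 1
          rw [smul_smul, hcg, one_smul]
        simp [h3]
      conv_lhs => rw [h2]
      simp only [smul_sub]
      exact (integral_sub ((hcont t).integrable_of_compactSpace μ)
        ((c.continuous.smul (F.continuous.comp (map_continuous f))).integrable_of_compactSpace
          μ)).symm
    rw [dist_comm] at ht
    refine lt_of_le_of_lt ?_ ht
    rw [h1]
    refine (norm_integral_le_of_norm_le_const (μ := μ) (C := dist (α.ellwoodMap t) F)
      (.of_forall fun z => ?_)).trans_eq (by simp)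
    have h4 : ‖c z‖ = 1 := Circle.norm_coe (χ⁻¹ z)
    rw [norm_smul, h4, one_mul, ← dist_eq_norm]
    exact ContinuousMap.dist_apply_le_dist _
  -- `w ∈ M` is within distance one of `1`, hence invertible. It is a fixed point, so `w⁻¹`
  -- preserves `M` and `1 = w⁻¹ w ∈ M`.
  set w := θ.average μ 1 p
  have hw1 : ‖1 - w‖ < 1 := by
    have h1 : w - 1 = θ.average μ 1 (p - 1) := by
      rw [map_sub, θ.average_one_of_fixed (fun z => map_one (θ.act z))]
    rw [norm_sub_rev, h1]
    exact (θ.norm_average_one_le _).trans_lt hp1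
  obtain ⟨u, hu⟩ : IsUnit w := by
    simpa using isUnit_one_sub_of_norm_lt_one hw1
  have hfix : (u : A) ∈ θ.isotypic 1 := by
    rw [hu, mem_isotypic_one]
    exact θ.average_one_mem_fixedPoints p
  have hmul : ∀ x ∈ M, ((u⁻¹ : Aˣ) : A) * x ∈ M := fun x hx => by
    induction hx using Submodule.mul_induction_on' with
    | mem_mul_mem m hm n hn =>
      rw [← mul_assoc]
      have := θ.mul_mem_isotypic (θ.inv_mem_isotypic_one hfix) hm
      rw [one_mul] at this
      exact Submodule.mul_mem_mul this hn
    | add x _ y _ hx hy =>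
      rw [mul_add]
      exact add_mem hx hy
  have := hmul w (hP t)
  rwa [← hu, Units.inv_mul] at this

end CStarSystem

/-! ### The grading of a `Ĝ`-structure by `Z*` -/

theorem CentralExtension.mul_comm {Z Ghat G : Type*} [Group Z] [TopologicalSpace Z] [Group Ghat]
    [TopologicalSpace Ghat] [Group G] [TopologicalSpace G] (E : CentralExtension Z Ghat G)
    (a b : Z) : a * b = b * a :=
  E.injective_ι (by rw [map_mul, map_mul, E.central])

namespace HatStructure

variable {Z Ghat G A Ahat : Type*} [Group Z] [TopologicalSpace Z] [Group Ghat]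
  [TopologicalSpace Ghat] [Group G] [TopologicalSpace G] [CStarAlgebra A] [CStarAlgebra Ahat]
  {E : CentralExtension Z Ghat G} {α : CStarSystem G A} (S : HatStructure E α Ahat)

theorem mem_isotypic_one_iff {x : Ahat} : x ∈ S.θ.isotypic 1 ↔ ∃ a, S.j a = x := by
  rw [CStarSystem.mem_isotypic_one]
  exact (Set.ext_iff.1 S.range_j x).symm

theorem j_mul_mem {χ : PontryaginDual Z} {x : Ahat} (a : A) (hx : x ∈ S.θ.isotypic χ) :
    S.j a * x ∈ S.θ.isotypic χ := by
  simpa using S.θ.mul_mem_isotypic (S.mem_isotypic_one_iff.2 ⟨a, rfl⟩) hx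

theorem mul_j_mem {χ : PontryaginDual Z} {x : Ahat} (a : A) (hx : x ∈ S.θ.isotypic χ) :
    x * S.j a ∈ S.θ.isotypic χ := by
  simpa using S.θ.mul_mem_isotypic hx (S.mem_isotypic_one_iff.2 ⟨a, rfl⟩)

theorem exists_j_eq_mul {χ χ' : PontryaginDual Z} (h : χ * χ' = 1) {x y : Ahat}
    (hx : x ∈ S.θ.isotypic χ) (hy : y ∈ S.θ.isotypic χ') : ∃ a, S.j a = x * y :=
  S.mem_isotypic_one_iff.1 (h ▸ S.θ.mul_mem_isotypic hx hy)

theorem coe_centralUnitaries_comm (u : centralUnitaries A) (a : A) :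
    S.j ((u : unitary A) : A) * S.j a = S.j a * S.j ((u : unitary A) : A) := by
  rw [← map_mul, u.2 a, map_mul]

theorem star_j_mul_j (u : centralUnitaries A) :
    star (S.j ((u : unitary A) : A)) * S.j ((u : unitary A) : A) = 1 := by
  rw [← map_star, ← map_mul, Unitary.star_mul_self_of_mem u.1.2, map_one]

theorem j_mul_star_j (u : centralUnitaries A) :
    S.j ((u : unitary A) : A) * star (S.j ((u : unitary A) : A)) = 1 := by
  rw [← map_star, ← map_mul, Unitary.mul_star_self_of_mem u.1.2, map_one]

theorem j_coe_mul (u v : centralUnitaries A) :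
    S.j (((u * v : centralUnitaries A) : unitary A) : A) =
      S.j ((u : unitary A) : A) * S.j ((v : unitary A) : A) :=
  map_mul S.j _ _

theorem j_coe_one : S.j (((1 : centralUnitaries A) : unitary A) : A) = 1 :=
  map_one S.j

theorem j_coe_injective {u v : centralUnitaries A}
    (h : S.j ((u : unitary A) : A) = S.j ((v : unitary A) : A)) : u = v :=
  Subtype.ext (Subtype.ext (S.injective_j h))

theorem map_mem_isotypic {φ : Ahat ≃⋆ₐ[ℂ] Ahat} (hφ : φ ∈ S.gaugeGroup) {χ : PontryaginDual Z}
    {x : Ahat} (hx : x ∈ S.θ.isotypic χ) : φ x ∈ S.θ.isotypic χ := fun z => by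
  rw [hφ.1, hx z, map_smul]

/-! ### The graph of a crossed homomorphism -/

section Graph

variable {S} {Δ : PontryaginDual Z →* MulAut (centralUnitaries A)}

/-- The linear span of the graph of `x ↦ c(χ) x` on the isotypic components. -/
def graph (S : HatStructure E α Ahat) (c : PontryaginDual Z → centralUnitaries A) :
    Submodule ℂ (Ahat × Ahat) :=
  Submodule.span ℂ
    {p | ∃ χ, p.1 ∈ S.θ.isotypic χ ∧ p.2 = S.j ((c χ : unitary A) : A) * p.1}

theorem mem_graph (c : PontryaginDual Z → centralUnitaries A) {χ : PontryaginDual Z} {x : Ahat}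
    (hx : x ∈ S.θ.isotypic χ) : (x, S.j ((c χ : unitary A) : A) * x) ∈ S.graph c :=
  Submodule.subset_span ⟨χ, hx, rfl⟩

theorem apply_one_of_mem_crossedHoms {c : PontryaginDual Z → centralUnitaries A}
    (hc : c ∈ crossedHoms Δ) : c 1 = 1 := by
  have h := hc 1 1
  rw [one_mul, map_one] at h
  exact left_eq_mul.1 h

/-- The cocycle identity at `(χ⁻¹, χ)` gives `c(χ⁻¹) = Δ_{χ⁻¹}(c(χ)⁻¹)`, and `Δ_{χ⁻¹}` is what moves
a central unitary past `star x`. -/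
theorem star_mul_coe_crossedHom (hΔ : S.IsFrohlichMap Δ)
    {c : PontryaginDual Z → centralUnitaries A} (hc : c ∈ crossedHoms Δ) {χ : PontryaginDual Z}
    {x : Ahat} (hx : x ∈ S.θ.isotypic χ) :
    star (S.j ((c χ : unitary A) : A) * x) = S.j ((c χ⁻¹ : unitary A) : A) * star x := by
  have h1 : c χ⁻¹ = Δ χ⁻¹ (c χ)⁻¹ := by
    have := hc χ⁻¹ χ
    rw [inv_mul_cancel, apply_one_of_mem_crossedHoms hc] at this
    rw [map_inv]
    exact eq_inv_of_mul_eq_one_left this.symm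
  rw [h1, hΔ _ _ _ (S.θ.star_mem_isotypic hx), star_mul, ← map_star]
  rfl

/-- The graph of `x ↦ c(χ) x` as a *-algebra. -/
def IsFrohlichMap.graphAlgebra (hΔ : S.IsFrohlichMap Δ)
    {c : PontryaginDual Z → centralUnitaries A} (hc : c ∈ crossedHoms Δ) :
    StarSubalgebra ℂ (Ahat × Ahat) where
  carrier := S.graph c
  add_mem' := add_mem
  zero_mem' := zero_mem _
  mul_mem' {p q} hp hq := by
    change p * q ∈ S.graph c
    induction hp, hq using Submodule.span_induction₂ with
    | mem_mem p q hp hq =>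
      obtain ⟨χ, hx, hp⟩ := hp
      obtain ⟨χ', hy, hq⟩ := hq
      -- Moving `c χ'` rightwards across `p.1` undoes `Δ χ`, so the cocycle identity is exactly
      -- multiplicativity.
      have h := mem_graph (S := S) c (S.θ.mul_mem_isotypic hx hy)
      rw [hc χ χ', S.j_coe_mul, mul_assoc, ← mul_assoc _ p.1, hΔ χ _ _ hx, mul_assoc p.1,
        ← mul_assoc _ p.1, ← hp, ← hq] at h
      exact h
    | zero_left q _ => simp
    | zero_right p _ => simp
    | add_left p q r _ _ _ h h' =>
      rw [add_mul]
      exact add_mem h h'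
    | add_right p q r _ _ _ h h' =>
      rw [mul_add]
      exact add_mem h h'
    | smul_left r p q _ _ h =>
      rw [smul_mul_assoc]
      exact Submodule.smul_mem _ r h
    | smul_right r p q _ _ h =>
      rw [mul_smul_comm]
      exact Submodule.smul_mem _ r h
  one_mem' := by
    have h := mem_graph (S := S) c (x := 1) (S.mem_isotypic_one_iff.2 ⟨1, map_one S.j⟩)
    rwa [apply_one_of_mem_crossedHoms hc, S.j_coe_one, one_mul] at h
  algebraMap_mem' r := by
    have h := mem_graph (S := S) c (x := 1) (S.mem_isotypic_one_iff.2 ⟨1, map_one S.j⟩)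
    rw [apply_one_of_mem_crossedHoms hc, S.j_coe_one, one_mul] at h
    rw [Algebra.algebraMap_eq_smul_one]
    exact Submodule.smul_mem _ r h
  star_mem' {p} hp := by
    change star p ∈ S.graph c
    induction hp using Submodule.span_induction with
    | mem p hp =>
      obtain ⟨χ, hx, hp⟩ := hp
      have h := mem_graph c (S.θ.star_mem_isotypic hx)
      rw [← star_mul_coe_crossedHom hΔ hc hx, ← hp] at h
      exact h
    | zero => simp
    | add p q _ _ h h' =>
      rw [star_add]
      exact add_mem h h'
    | smul r p _ h =>
      rw [star_smul]
      exact Submodule.smul_mem _ _ h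

open MeasureTheory in
theorem average_fst_eq_average_snd [IsTopologicalGroup Z] [CompactSpace Z]
    [MeasurableSpace Z] [BorelSpace Z] (μ : Measure Z)
    [IsProbabilityMeasure μ] [μ.IsMulLeftInvariant] {c : PontryaginDual Z → centralUnitaries A}
    (hc : c 1 = 1) {p : Ahat × Ahat} (hp : p ∈ S.graph c) :
    S.θ.average μ 1 p.1 = S.θ.average μ 1 p.2 := by
  induction hp using Submodule.span_induction with
  | mem p hp =>
    obtain ⟨χ, hx, hp⟩ := hp
    rw [hp]
    rcases eq_or_ne χ 1 with rfl | hχ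
    · rw [hc, S.j_coe_one, one_mul]
    · rw [S.θ.average_one_of_mem_isotypic hχ hx,
        S.θ.average_one_of_mem_isotypic hχ (S.j_mul_mem _ hx)]
  | zero => rfl
  | add p q _ _ h h' => rw [Prod.fst_add, Prod.snd_add, map_add, map_add, h, h']
  | smul r p _ h => rw [Prod.smul_fst, Prod.smul_snd, map_smul, map_smul, h]

theorem dense_fst_graph [IsTopologicalGroup Z] [CompactSpace Z] [T2Space Z]
    (c : PontryaginDual Z → centralUnitaries A) :
    Dense (Prod.fst '' (S.graph c : Set (Ahat × Ahat))) := by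
  refine (S.θ.dense_iSup_isotypic E.mul_comm).mono ?_
  have : (⨆ χ, S.θ.isotypic χ) ≤ (S.graph c).map (LinearMap.fst ℂ Ahat Ahat) :=
    iSup_le fun χ x hx => ⟨_, mem_graph c hx, rfl⟩
  exact this

theorem dense_snd_graph [IsTopologicalGroup Z] [CompactSpace Z] [T2Space Z]
    (c : PontryaginDual Z → centralUnitaries A) :
    Dense (Prod.snd '' (S.graph c : Set (Ahat × Ahat))) := by
  refine (S.θ.dense_iSup_isotypic E.mul_comm).mono ?_
  have : (⨆ χ, S.θ.isotypic χ) ≤ (S.graph c).map (LinearMap.snd ℂ Ahat Ahat) := by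
    refine iSup_le fun χ x hx => ⟨_, mem_graph c (S.j_mul_mem (star ((c χ : unitary A) : A)) hx), ?_⟩
    change S.j _ * (S.j _ * x) = x
    rw [map_star, ← mul_assoc, S.j_mul_star_j, one_mul]
  exact this

end Graph

/-! ### Central unitaries from bimodule maps -/

section Compact

variable [IsTopologicalGroup Z] [CompactSpace Z] [T2Space Z] [IsTopologicalGroup Ghat]
  [CompactSpace Ghat] [T2Space Ghat]

theorem one_mem_isotypic_mul (χ : PontryaginDual Z) :
    1 ∈ S.θ.isotypic χ * S.θ.isotypic χ⁻¹ := by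
  have := S.free.one_mem_isotypic_mul E.injective_ι χ⁻¹
  rwa [inv_inv] at this

/-- Insert `1 = ∑ mᵢ nᵢ` in front of `x`; each `nᵢ x` has type `χ'`. -/
theorem isotypic_mul_le (χ χ' : PontryaginDual Z) :
    S.θ.isotypic (χ * χ') ≤ S.θ.isotypic χ * S.θ.isotypic χ' := fun x hx => by
  have h : ∀ t ∈ S.θ.isotypic χ * S.θ.isotypic χ⁻¹,
      t * x ∈ S.θ.isotypic χ * S.θ.isotypic χ' := fun t ht => by
    induction ht using Submodule.mul_induction_on' with
    | mem_mul_mem m hm n hn =>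
      rw [mul_assoc]
      refine Submodule.mul_mem_mul hm ?_
      simpa using S.θ.mul_mem_isotypic hn hx
    | add s _ t _ hs ht =>
      rw [add_mul]
      exact add_mem hs ht
  simpa using h 1 (S.one_mem_isotypic_mul χ)

theorem ext_left (χ : PontryaginDual Z) {w w' : Ahat}
    (h : ∀ x ∈ S.θ.isotypic χ, w * x = w' * x) : w = w' := by
  have h' : ∀ t ∈ S.θ.isotypic χ * S.θ.isotypic χ⁻¹, w * t = w' * t := fun t ht => by
    induction ht using Submodule.mul_induction_on' with
    | mem_mul_mem m hm n hn => rw [← mul_assoc, h m hm, mul_assoc]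
    | add s _ t _ hs ht => rw [mul_add, hs, ht, mul_add]
  simpa using h' 1 (S.one_mem_isotypic_mul χ)

theorem ext_centralUnitaries (χ : PontryaginDual Z) {u v : centralUnitaries A}
    (h : ∀ x ∈ S.θ.isotypic χ,
      S.j ((u : unitary A) : A) * x = S.j ((v : unitary A) : A) * x) : u = v :=
  S.j_coe_injective (S.ext_left χ h)

/-- Bimodule unitaries of an isotypic component are given by central unitaries. -/
theorem exists_centralUnitary (χ : PontryaginDual Z) (T : Ahat →+ Ahat)
    (hmem : ∀ x ∈ S.θ.isotypic χ, T x ∈ S.θ.isotypic χ)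
    (hr : ∀ x ∈ S.θ.isotypic χ, ∀ a, T (x * S.j a) = T x * S.j a)
    (hl : ∀ x ∈ S.θ.isotypic χ, ∀ a, T (S.j a * x) = S.j a * T x)
    (hinner : ∀ x ∈ S.θ.isotypic χ, ∀ y ∈ S.θ.isotypic χ, star (T x) * T y = star x * y)
    (hsurj : ∀ x ∈ S.θ.isotypic χ, ∃ y ∈ S.θ.isotypic χ, T y = x) :
    ∃ u : centralUnitaries A, ∀ x ∈ S.θ.isotypic χ, S.j ((u : unitary A) : A) * x = T x := by
  -- For `t = m n` take `a = T(m) n`: as `n x` lies in `A`, right linearity gives `T(m n x) = T(m) n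
  -- x`.
  have h : ∀ t ∈ S.θ.isotypic χ * S.θ.isotypic χ⁻¹,
      ∃ a, ∀ x ∈ S.θ.isotypic χ, S.j a * x = T (t * x) := fun t ht => by
    induction ht using Submodule.mul_induction_on' with
    | mem_mul_mem m hm n hn =>
      obtain ⟨a, ha⟩ := S.exists_j_eq_mul (mul_inv_cancel χ) (hmem m hm) hn
      refine ⟨a, fun x hx => ?_⟩
      obtain ⟨b, hb⟩ := S.exists_j_eq_mul (inv_mul_cancel χ) hn hx
      rw [ha, mul_assoc, mul_assoc, ← hb, hr m hm]
    | add s _ t _ hs ht =>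
      obtain ⟨a, ha⟩ := hs
      obtain ⟨b, hb⟩ := ht
      refine ⟨a + b, fun x hx => ?_⟩
      rw [map_add, add_mul, ha x hx, hb x hx, add_mul, map_add]
  obtain ⟨a, ha⟩ := h 1 (S.one_mem_isotypic_mul χ)
  simp only [one_mul] at ha
  have hcentral : ∀ b, a * b = b * a := fun b => S.injective_j (S.ext_left χ fun x hx => by
    rw [map_mul, map_mul, mul_assoc, mul_assoc, ha x hx, ha _ (S.j_mul_mem b hx), hl x hx])
  have h1 : star a * a = 1 := S.injective_j (S.ext_left χ fun x hx => by
    -- Taking adjoints allows cancelling a component on the other side too, leaving the preserved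
    -- inner product.
    refine star_injective (S.ext_left χ fun y hy => ?_)
    have h := hinner x hx y hy
    rw [← ha x hx, ← ha y hy, star_mul, mul_assoc, ← mul_assoc (star (S.j a))] at h
    rw [star_mul, mul_assoc, ← map_star, star_mul, star_star, map_mul, map_star, h, map_one,
      one_mul])
  have h2 : a * star a = 1 := S.injective_j (S.ext_left χ fun x hx => by
    obtain ⟨y, hy, rfl⟩ := hsurj x hx
    rw [← ha y hy, ← mul_assoc, ← map_mul, mul_assoc, h1, mul_one, map_one, one_mul])
  exact ⟨⟨⟨a, Unitary.mem_iff.2 ⟨h1, h2⟩⟩, hcentral⟩, ha⟩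

/-! ### The Fröhlich map -/

theorem exists_frohlich (χ : PontryaginDual Z) (u : centralUnitaries A) :
    ∃ v : centralUnitaries A, ∀ x ∈ S.θ.isotypic χ,
      S.j ((v : unitary A) : A) * x = x * S.j ((u : unitary A) : A) := by
  refine S.exists_centralUnitary χ (AddMonoidHom.mulRight (S.j ((u : unitary A) : A)))
    (fun x hx => S.mul_j_mem _ hx) (fun x _ a => ?_) (fun x _ a => mul_assoc _ _ _)
    (fun x hx y hy => ?_) (fun x hx => ?_)
  · change x * S.j a * S.j _ = x * S.j _ * S.j a
    rw [mul_assoc, mul_assoc, S.coe_centralUnitaries_comm]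
  · change star (x * S.j _) * (y * S.j _) = star x * y
    obtain ⟨b, hb⟩ := S.exists_j_eq_mul (inv_mul_cancel χ) (S.θ.star_mem_isotypic hx) hy
    rw [star_mul, mul_assoc, ← mul_assoc (star x), ← hb, ← S.coe_centralUnitaries_comm,
      ← mul_assoc, S.star_j_mul_j, one_mul]
  · refine ⟨x * S.j (star ((u : unitary A) : A)), S.mul_j_mem _ hx, ?_⟩
    change x * S.j _ * S.j _ = x
    rw [mul_assoc, map_star, S.star_j_mul_j, mul_one]

/-- The Fröhlich map, as a family of functions. -/
def frohlichFun (χ : PontryaginDual Z) (u : centralUnitaries A) : centralUnitaries A :=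
  (S.exists_frohlich χ u).choose

theorem frohlichFun_spec (χ : PontryaginDual Z) (u : centralUnitaries A) {x : Ahat}
    (hx : x ∈ S.θ.isotypic χ) :
    S.j ((S.frohlichFun χ u : unitary A) : A) * x = x * S.j ((u : unitary A) : A) :=
  (S.exists_frohlich χ u).choose_spec x hx

theorem frohlichFun_one (u : centralUnitaries A) : S.frohlichFun 1 u = u :=
  S.ext_centralUnitaries 1 fun x hx => by
    obtain ⟨a, rfl⟩ := S.mem_isotypic_one_iff.1 hx
    rw [S.frohlichFun_spec 1 u hx, S.coe_centralUnitaries_comm]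

theorem frohlichFun_mul (χ χ' : PontryaginDual Z) (u : centralUnitaries A) :
    S.frohlichFun (χ * χ') u = S.frohlichFun χ (S.frohlichFun χ' u) :=
  S.ext_centralUnitaries (χ * χ') fun x hx => by
    rw [S.frohlichFun_spec _ u hx]
    replace hx := S.isotypic_mul_le χ χ' hx
    induction hx using Submodule.mul_induction_on' with
    | mem_mul_mem m hm n hn =>
      rw [← mul_assoc, S.frohlichFun_spec _ _ hm, mul_assoc, mul_assoc, S.frohlichFun_spec _ _ hn]
    | add s _ t _ hs ht => rw [add_mul, mul_add, hs, ht]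

/-- The Fröhlich map. -/
def frohlichMap : PontryaginDual Z →* MulAut (centralUnitaries A) where
  toFun χ :=
    { toFun := S.frohlichFun χ
      invFun := S.frohlichFun χ⁻¹
      left_inv := fun u => by rw [← S.frohlichFun_mul, inv_mul_cancel, S.frohlichFun_one]
      right_inv := fun u => by rw [← S.frohlichFun_mul, mul_inv_cancel, S.frohlichFun_one]
      map_mul' := fun u v => S.ext_centralUnitaries χ fun x hx => by
        rw [S.frohlichFun_spec _ _ hx, S.j_coe_mul, S.j_coe_mul, mul_assoc,
          S.frohlichFun_spec _ v hx, ← mul_assoc, ← mul_assoc, S.frohlichFun_spec _ u hx] }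
  map_one' := MulEquiv.ext S.frohlichFun_one
  map_mul' χ χ' := MulEquiv.ext (S.frohlichFun_mul χ χ')

theorem existsUnique_frohlichMap :
    ∃! Δ : PontryaginDual Z →* MulAut (centralUnitaries A), S.IsFrohlichMap Δ :=
  ⟨S.frohlichMap, fun χ u _ hx => S.frohlichFun_spec χ u hx, fun _ hΔ =>
    MonoidHom.ext fun χ => MulEquiv.ext fun u => S.ext_centralUnitaries χ fun x hx =>
      (hΔ χ u x hx).trans (S.frohlichFun_spec χ u hx).symm⟩

/-! ### Gauge transformations and crossed homomorphisms -/

theorem exists_gauge (φ : S.gaugeGroup) (χ : PontryaginDual Z) :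
    ∃ c : centralUnitaries A, ∀ x ∈ S.θ.isotypic χ,
      S.j ((c : unitary A) : A) * x = (φ : Ahat ≃⋆ₐ[ℂ] Ahat) x := by
  obtain ⟨φ, hφ⟩ := φ
  refine S.exists_centralUnitary χ (φ : Ahat →+ Ahat) (fun x hx => S.map_mem_isotypic hφ hx)
    (fun x _ a => ?_) (fun x _ a => ?_) (fun x hx y hy => ?_) (fun x hx => ?_)
  · change φ (x * S.j a) = φ x * S.j a
    rw [map_mul, hφ.2]
  · change φ (S.j a * x) = S.j a * φ x
    rw [map_mul, hφ.2]
  · change star (φ x) * φ y = star x * y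
    -- The inner product `star x * y` lies in `A`, where `φ` is the identity.
    obtain ⟨b, hb⟩ := S.exists_j_eq_mul (inv_mul_cancel χ) (S.θ.star_mem_isotypic hx) hy
    rw [← map_star, ← map_mul, ← hb, hφ.2]
  · exact ⟨φ⁻¹ x, S.map_mem_isotypic (inv_mem hφ) hx, φ.apply_symm_apply x⟩

/-- The function `Z* → 𝒰(Z(A))` of a gauge transformation. -/
def gaugeFun (φ : S.gaugeGroup) (χ : PontryaginDual Z) : centralUnitaries A :=
  (S.exists_gauge φ χ).choose

theorem gaugeFun_spec (φ : S.gaugeGroup) (χ : PontryaginDual Z) {x : Ahat}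
    (hx : x ∈ S.θ.isotypic χ) :
    S.j ((S.gaugeFun φ χ : unitary A) : A) * x = (φ : Ahat ≃⋆ₐ[ℂ] Ahat) x :=
  (S.exists_gauge φ χ).choose_spec x hx

section Cocycle

variable {S} {Δ : PontryaginDual Z →* MulAut (centralUnitaries A)}

theorem IsFrohlichMap.gaugeFun_mem (hΔ : S.IsFrohlichMap Δ) (φ : S.gaugeGroup) : S.gaugeFun φ ∈ crossedHoms Δ :=
  fun χ χ' => S.ext_centralUnitaries (χ * χ') fun x hx => by
    rw [S.gaugeFun_spec _ _ hx, S.j_coe_mul]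
    replace hx := S.isotypic_mul_le χ χ' hx
    induction hx using Submodule.mul_induction_on' with
    | mem_mul_mem m hm n hn =>
      rw [mul_assoc, ← mul_assoc _ m, hΔ χ _ m hm, mul_assoc m, S.gaugeFun_spec _ _ hn, ← mul_assoc,
        S.gaugeFun_spec _ _ hm, map_mul]
    | add s _ t _ hs ht => rw [map_add, mul_add, hs, ht]

/-- The homomorphism from the gauge group to the crossed homomorphisms. -/
def IsFrohlichMap.gaugeHom (hΔ : S.IsFrohlichMap Δ) : S.gaugeGroup →* crossedHoms Δ where
  toFun φ := ⟨S.gaugeFun φ, hΔ.gaugeFun_mem φ⟩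
  map_one' := Subtype.ext <| funext fun χ => S.ext_centralUnitaries χ fun x hx => by
    change S.j ((S.gaugeFun 1 χ : unitary A) : A) * x =
      S.j (((1 : centralUnitaries A) : unitary A) : A) * x
    rw [S.gaugeFun_spec _ _ hx, S.j_coe_one, one_mul]
    rfl
  map_mul' φ ψ := Subtype.ext <| funext fun χ => S.ext_centralUnitaries χ fun x hx => by
    change S.j ((S.gaugeFun (φ * ψ) χ : unitary A) : A) * x =
      S.j (((S.gaugeFun φ χ * S.gaugeFun ψ χ : centralUnitaries A) : unitary A) : A) * x
    rw [S.gaugeFun_spec _ _ hx, S.j_coe_mul, mul_assoc, S.gaugeFun_spec _ _ hx,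
      S.gaugeFun_spec _ _ (S.map_mem_isotypic ψ.2 hx)]
    rfl

theorem IsFrohlichMap.gaugeHom_injective (hΔ : S.IsFrohlichMap Δ) :
    Function.Injective hΔ.gaugeHom := fun φ ψ h => by
  have h1 : S.gaugeFun φ = S.gaugeFun ψ := congrArg Subtype.val h
  have hcont : ∀ φ : Ahat ≃⋆ₐ[ℂ] Ahat, Continuous φ := fun φ => (StarAlgEquiv.isometry φ).continuous
  have h2 := S.θ.ext_of_isotypic E.mul_comm (f := ((φ : Ahat ≃⋆ₐ[ℂ] Ahat) : Ahat →ₗ[ℂ] Ahat))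
    (g := ((ψ : Ahat ≃⋆ₐ[ℂ] Ahat) : Ahat →ₗ[ℂ] Ahat)) (hcont φ) (hcont ψ) fun χ x hx =>
      ((S.gaugeFun_spec φ χ hx).symm.trans (by rw [h1])).trans (S.gaugeFun_spec ψ χ hx)
  exact Subtype.ext (StarAlgEquiv.ext fun x => congr($h2 x))

theorem IsFrohlichMap.gaugeHom_surjective (hΔ : S.IsFrohlichMap Δ) :
    Function.Surjective hΔ.gaugeHom := by
  rintro ⟨c, hc⟩
  let _ : MeasurableSpace Z := borel Z
  have _ : BorelSpace Z := ⟨rfl⟩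
  let μ : MeasureTheory.Measure Z := MeasureTheory.Measure.haarMeasure ⊤
  have _ : MeasureTheory.IsProbabilityMeasure μ := ⟨MeasureTheory.Measure.haarMeasure_self⟩
  have hc1 := apply_one_of_mem_crossedHoms hc
  -- The graph algebra plays the role of `B`, with its coordinate projections as `π₁` and `π₂`; no
  -- norm bound on `x ↦ c(χ) x` is needed beforehand.
  obtain ⟨φ, hφ⟩ := S.θ.exists_starAlgEquiv_of_average_eq (μ := μ)
    ((StarAlgHom.fst ℂ Ahat Ahat).comp (hΔ.graphAlgebra hc).subtype)
    ((StarAlgHom.snd ℂ Ahat Ahat).comp (hΔ.graphAlgebra hc).subtype)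
    (fun p => average_fst_eq_average_snd μ hc1 p.2)
    ((dense_fst_graph (S := S) c).mono (by rintro _ ⟨p, hp, rfl⟩; exact ⟨⟨p, hp⟩, rfl⟩))
    ((dense_snd_graph (S := S) c).mono (by rintro _ ⟨p, hp, rfl⟩; exact ⟨⟨p, hp⟩, rfl⟩))
  have hφ' : ∀ χ, ∀ x ∈ S.θ.isotypic χ, φ x = S.j ((c χ : unitary A) : A) * x :=
    fun χ x hx => hφ ⟨_, mem_graph c hx⟩
  have hmem : φ ∈ S.gaugeGroup := by
    refine ⟨fun z x => ?_, fun a => ?_⟩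
    · have hcont : ∀ φ : Ahat ≃⋆ₐ[ℂ] Ahat, Continuous φ :=
        fun φ => (StarAlgEquiv.isometry φ).continuous
      have h := S.θ.ext_of_isotypic E.mul_comm
        (f := ((S.θ.act z : Ahat ≃⋆ₐ[ℂ] Ahat) : Ahat →ₗ[ℂ] Ahat) ∘ₗ (φ : Ahat →ₗ[ℂ] Ahat))
        (g := (φ : Ahat →ₗ[ℂ] Ahat) ∘ₗ ((S.θ.act z : Ahat ≃⋆ₐ[ℂ] Ahat) : Ahat →ₗ[ℂ] Ahat))
        ((hcont _).comp (hcont φ)) ((hcont φ).comp (hcont _)) fun χ x hx => by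
          change S.θ.act z (φ x) = φ (S.θ.act z x)
          rw [hx z, map_smul, hφ' χ x hx, S.j_mul_mem _ hx z]
      exact congr($h x)
    · rw [hφ' 1 _ (S.mem_isotypic_one_iff.2 ⟨a, rfl⟩), hc1, S.j_coe_one, one_mul]
  refine ⟨⟨φ, hmem⟩, Subtype.ext <| funext fun χ => S.ext_centralUnitaries χ fun x hx => ?_⟩
  exact (S.gaugeFun_spec ⟨φ, hmem⟩ χ hx).trans (hφ' χ x hx)

/-- The gauge group is isomorphic to the group of crossed homomorphisms. -/
def IsFrohlichMap.gaugeEquiv (hΔ : S.IsFrohlichMap Δ) : S.gaugeGroup ≃* crossedHoms Δ :=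
  MulEquiv.ofBijective hΔ.gaugeHom ⟨hΔ.gaugeHom_injective, hΔ.gaugeHom_surjective⟩

end Cocycle

end Compact

end HatStructure

end

theorem mainTheorem3 {Z Ghat G A Ahat : Type*}
    [Group Z] [TopologicalSpace Z] [IsTopologicalGroup Z] [CompactSpace Z] [T2Space Z]
    [Group Ghat] [TopologicalSpace Ghat] [IsTopologicalGroup Ghat] [CompactSpace Ghat]
    [T2Space Ghat]
    [Group G] [TopologicalSpace G] [IsTopologicalGroup G] [CompactSpace G] [T2Space G]
    [CStarAlgebra A] [CStarAlgebra Ahat]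
    (E : CentralExtension Z Ghat G) (α : CStarSystem G A) (hα : α.IsFree)
    (S : HatStructure E α Ahat) :
    (∃! Δ : PontryaginDual Z →* MulAut (centralUnitaries A), S.IsFrohlichMap Δ) ∧
    (∀ Δ : PontryaginDual Z →* MulAut (centralUnitaries A), S.IsFrohlichMap Δ →
      ∃ Φ : S.gaugeGroup ≃* crossedHoms Δ,
        ∀ (φ : S.gaugeGroup) (χ : PontryaginDual Z), ∀ x ∈ S.θ.isotypic χ,
          (φ : Ahat ≃⋆ₐ[ℂ] Ahat) x =
            S.j ((((Φ φ : PontryaginDual Z → centralUnitaries A) χ : centralUnitaries A) :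
              unitary A) : A) * x) ∧
    (∀ φ ∈ S.gaugeGroup, ∀ ψ ∈ S.gaugeGroup, φ * ψ = ψ * φ) := by
  refine ⟨S.existsUnique_frohlichMap, fun Δ hΔ => ⟨hΔ.gaugeEquiv, fun φ χ x hx =>
    (S.gaugeFun_spec φ χ hx).symm⟩, fun φ hφ ψ hψ => ?_⟩
  obtain ⟨Δ, hΔ, -⟩ := S.existsUnique_frohlichMap
  have h : (⟨φ, hφ⟩ : S.gaugeGroup) * ⟨ψ, hψ⟩ = ⟨ψ, hψ⟩ * ⟨φ, hφ⟩ :=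
    hΔ.gaugeHom_injective (by rw [map_mul, map_mul, mul_comm])
  exact congrArg Subtype.val h
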